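/- Let $\Omega\subset\mathbb{R}^3$ be a bounded open set with Lipschitz boundary, that is: every $x\in\partial\Omega$ has an open neighbourhood $V$ in which, for suitable orthonormal coordinates $(y_1,y_2,y_3)$ and some Lipschitz function $h:\mathbb{R}^2\to\mathbb{R}$, one has $\Omega\cap V=\{y\in V : y_3>h(y_1,y_2)\}$. (In particular, $\Omega$ may be any bounded Lipschitz domain; connectedness is not needed.) Let $1<p<\infty$. Let $$W^p(\mathrm{curl};\Omega)=\{u\in L^p(\Omega)^3 : \nabla\times u\in L^p(\Omega)^3\},\qquad \|u\|_{W^p(\mathrm{curl};\Omega)}=\|u\|_{L^p(\Omega)}+\|\nabla\times u\|_{L^p(\Omega)},$$ where the fields are real-valued and $\nabla\times u$ is the distributional curl, i.e. $\int_\Omega(\nabla\times u)\cdot\varphi\,dx=\int_\Omega u\cdot(\nabla\times\varphi)\,dx$ for all $\varphi\in C_0^\infty(\Omega)^3$. Let $C^\infty(\overline\Omega)^3$ denote the set of restrictions to $\Omega$ of smooth vector fields $\mathbb{R}^3\to\mathbb{R}^3$. Then $C^\infty(\overline\Omega)^3$ is contained in $W^p(\mathrm{curl};\Omega)$ and is dense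 in it. -/

import Mathlib

open MeasureTheory TopologicalSpace
open scoped ENNReal ContDiff InnerProductSpace

noncomputable section

/-- Three-dimensional Euclidean space `ℝ³` (with the Euclidean norm and Lebesgue measure). -/
abbrev R3 : Type := EuclideanSpace ℝ (Fin 3)

/-- `Ω` has a Lipschitz boundary: near each boundary point, in suitable orthonormal coordinates
`(y₀, y₁, y₂)`, the set `Ω` is the region strictly above the graph of a Lipschitz function of
`(y₀, y₁)`; in particular the boundary is, near that point, the graph itself. -/
def HasLipschitzBoundary (Ω : Set R3) : Prop :=
  ∀ x ∈ frontier Ω, ∃ V : Set R3, IsOpen V ∧ x ∈ V ∧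
    ∃ (e : R3 ≃ₗᵢ[ℝ] R3) (K : NNReal) (h : EuclideanSpace ℝ (Fin 2) → ℝ), LipschitzWith K h ∧
      ∀ y ∈ V, (y ∈ Ω ↔ h !₂[e y 0, e y 1] < e y 2)

/-- The partial derivative `∂ᵢ φⱼ` at `x`. -/
def partialDeriv (φ : R3 → R3) (i j : Fin 3) (x : R3) : ℝ :=
  fderiv ℝ φ x (EuclideanSpace.single i 1) j

/-- The classical curl of a (differentiable) vector field. -/
def classicalCurl (φ : R3 → R3) (x : R3) : R3 :=
  !₂[partialDeriv φ 1 2 x - partialDeriv φ 2 1 x,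
     partialDeriv φ 2 0 x - partialDeriv φ 0 2 x,
     partialDeriv φ 0 1 x - partialDeriv φ 1 0 x]

/-- `φ ∈ C₀^∞(Ω)³`: a smooth vector field whose support is a compact subset of `Ω`. -/
structure IsTestField (Ω : Opens R3) (φ : R3 → R3) : Prop where
  contDiff : ContDiff ℝ ∞ φ
  hasCompactSupport : HasCompactSupport φ
  tsupport_subset : tsupport φ ⊆ Ω

/-- `w` is the curl of `u` in `Ω` in the sense of distributions. -/
def IsWeakCurl (Ω : Opens R3) (u w : R3 → R3) : Prop :=
  ∀ φ : R3 → R3, IsTestField Ω φ →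
    ∫ x in (Ω : Set R3), ⟪w x, φ x⟫_ℝ = ∫ x in (Ω : Set R3), ⟪u x, classicalCurl φ x⟫_ℝ

/-- `L^p(Ω)³`. -/
abbrev LpField (p : ℝ≥0∞) (Ω : Opens R3) : Type :=
  Lp R3 p (volume.restrict (Ω : Set R3))

theorem integrable_inner_of_hasCompactSupport {p : ℝ≥0∞} [hp : Fact (1 ≤ p)] {Ω : Opens R3}
    (u : LpField p Ω) {φ : R3 → R3} (hc : Continuous φ) (hs : HasCompactSupport φ) :
    Integrable (fun x => ⟪u x, φ x⟫_ℝ) (volume.restrict (Ω : Set R3)) := by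
  have h1 : LocallyIntegrable u (volume.restrict (Ω : Set R3)) :=
    (Lp.memLp u).locallyIntegrable hp.out
  have h2 : Integrable (fun x => ‖φ x‖ • u x) (volume.restrict (Ω : Set R3)) :=
    h1.integrable_smul_left_of_hasCompactSupport hc.norm hs.norm
  refine h2.mono ((Lp.aestronglyMeasurable u).inner hc.aestronglyMeasurable) ?_
  filter_upwards with x
  rw [norm_smul, norm_norm, mul_comm]
  exact norm_inner_le_norm _ _

theorem continuous_classicalCurl {φ : R3 → R3} (h : ContDiff ℝ ∞ φ) :
    Continuous (classicalCurl φ) := by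
  have hc : ∀ i j, Continuous (partialDeriv φ i j) := fun i j => by
    have h1 : Continuous (fderiv ℝ φ) := h.continuous_fderiv (by simp)
    unfold partialDeriv
    fun_prop
  unfold classicalCurl
  refine (PiLp.continuous_toLp 2 _).comp (continuous_pi fun i => ?_)
  fin_cases i
  · exact (hc 1 2).sub (hc 2 1)
  · exact (hc 2 0).sub (hc 0 2)
  · exact (hc 0 1).sub (hc 1 0)

theorem hasCompactSupport_classicalCurl {φ : R3 → R3} (h : HasCompactSupport φ) :
    HasCompactSupport (classicalCurl φ) := by
  refine (h.fderiv ℝ).mono fun x hx => ?_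
  contrapose! hx
  have h0 : fderiv ℝ φ x = 0 := by simpa using hx
  simp only [Function.mem_support, not_not]
  ext i
  fin_cases i <;> simp [classicalCurl, partialDeriv, h0]

theorem IsWeakCurl.add {p : ℝ≥0∞} [Fact (1 ≤ p)] {Ω : Opens R3} {u u' w w' : LpField p Ω}
    (h : IsWeakCurl Ω u w) (h' : IsWeakCurl Ω u' w') :
    IsWeakCurl Ω (u + u' : LpField p Ω) (w + w' : LpField p Ω) := by
  intro φ hφ
  have key : ∀ (a b : LpField p Ω) (ψ : R3 → R3), Continuous ψ → HasCompactSupport ψ →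
      ∫ x in (Ω : Set R3), ⟪(a + b : LpField p Ω) x, ψ x⟫_ℝ =
        (∫ x in (Ω : Set R3), ⟪a x, ψ x⟫_ℝ) + ∫ x in (Ω : Set R3), ⟪b x, ψ x⟫_ℝ := by
    intro a b ψ hc hs
    rw [← integral_add (integrable_inner_of_hasCompactSupport a hc hs)
      (integrable_inner_of_hasCompactSupport b hc hs)]
    refine integral_congr_ae ?_
    filter_upwards [Lp.coeFn_add a b] with x hx
    rw [hx, Pi.add_apply, inner_add_left]
  rw [key w w' φ hφ.contDiff.continuous hφ.hasCompactSupport,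
    key u u' _ (continuous_classicalCurl hφ.contDiff)
      (hasCompactSupport_classicalCurl hφ.hasCompactSupport), h φ hφ, h' φ hφ]

theorem IsWeakCurl.smul {p : ℝ≥0∞} {Ω : Opens R3} {u w : LpField p Ω} (c : ℝ)
    (h : IsWeakCurl Ω u w) : IsWeakCurl Ω (c • u : LpField p Ω) (c • w : LpField p Ω) := by
  intro φ hφ
  have key : ∀ (a : LpField p Ω) (ψ : R3 → R3),
      ∫ x in (Ω : Set R3), ⟪(c • a : LpField p Ω) x, ψ x⟫_ℝ =
        c * ∫ x in (Ω : Set R3), ⟪a x, ψ x⟫_ℝ := by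
    intro a ψ
    rw [← integral_const_mul]
    refine integral_congr_ae ?_
    filter_upwards [Lp.coeFn_smul c a] with x hx
    rw [hx, Pi.smul_apply, real_inner_smul_left]
  rw [key w φ, key u _, h φ hφ]

theorem IsWeakCurl.zero {p : ℝ≥0∞} {Ω : Opens R3} :
    IsWeakCurl Ω (0 : LpField p Ω) (0 : LpField p Ω) := by
  intro φ _
  have key : ∀ ψ : R3 → R3, ∫ x in (Ω : Set R3), ⟪(0 : LpField p Ω) x, ψ x⟫_ℝ = 0 := by
    intro ψ
    refine integral_eq_zero_of_ae ?_
    filter_upwards [Lp.coeFn_zero R3 p (volume.restrict (Ω : Set R3))] with x hx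
    rw [hx, Pi.zero_apply, inner_zero_left, Pi.zero_apply]
  rw [key, key]

/-- The weak curl is unique. -/
theorem IsWeakCurl.unique {p : ℝ≥0∞} [hp : Fact (1 ≤ p)] {Ω : Opens R3} {u w w' : LpField p Ω}
    (h : IsWeakCurl Ω u w) (h' : IsWeakCurl Ω u w') : w = w' := by
  have hi : ∀ i : Fin 3, ∀ᵐ x ∂volume, x ∈ (Ω : Set R3) → w x i - w' x i = 0 := by
    intro i
    have hloc : ∀ a : LpField p Ω, LocallyIntegrableOn (fun x => a x i) (Ω : Set R3) volume := by
      intro a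
      have h1 : LocallyIntegrableOn a (Ω : Set R3) volume :=
        (locallyIntegrableOn_of_locallyIntegrable_restrict
          ((Lp.memLp a).locallyIntegrable hp.out))
      intro x hx
      obtain ⟨s, hs, his⟩ := h1 x hx
      exact ⟨s, hs, (EuclideanSpace.proj (𝕜 := ℝ) i).integrable_comp his⟩
    refine Ω.isOpen.ae_eq_zero_of_integral_contDiff_smul_eq_zero ((hloc w).sub (hloc w')) ?_
    intro g hg hgs hgt
    have hφ : IsTestField Ω (fun x => g x • EuclideanSpace.single i (1 : ℝ)) := by
      refine ⟨hg.smul contDiff_const, hgs.smul_right, ?_⟩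
      exact (closure_mono (Function.support_smul_subset_left g _)).trans hgt
    have e := (h _ hφ).trans (h' _ hφ).symm
    have i1 := integrable_inner_of_hasCompactSupport w hφ.contDiff.continuous hφ.hasCompactSupport
    have i2 := integrable_inner_of_hasCompactSupport w' hφ.contDiff.continuous hφ.hasCompactSupport
    have e2 := sub_eq_zero.mpr e
    rw [← integral_sub i1 i2] at e2
    rw [← setIntegral_eq_integral_of_forall_compl_eq_zero (s := (Ω : Set R3)), ← e2]
    · refine integral_congr_ae ?_
      filter_upwards with x
      simp [inner_smul_right, EuclideanSpace.inner_single_right, mul_sub]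
    · intro x hx
      have : g x = 0 := by
        by_contra hne
        exact hx (hgt (subset_tsupport g hne))
      simp [this]
  refine Lp.ext ?_
  rw [Filter.EventuallyEq, ae_restrict_iff' Ω.isOpen.measurableSet]
  filter_upwards [hi 0, hi 1, hi 2] with x h0 h1 h2 hx
  ext i
  fin_cases i
  · exact sub_eq_zero.mp (h0 hx)
  · exact sub_eq_zero.mp (h1 hx)
  · exact sub_eq_zero.mp (h2 hx)

/-- The vector fields in `L^p(Ω)³` whose distributional curl lies in `L^p(Ω)³`. -/
def wCurlSubmodule (p : ℝ≥0∞) [Fact (1 ≤ p)] (Ω : Opens R3) : Submodule ℝ (LpField p Ω) where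
  carrier := {u | ∃ w : LpField p Ω, IsWeakCurl Ω u w}
  add_mem' := fun ⟨w, hw⟩ ⟨w', hw'⟩ => ⟨w + w', hw.add hw'⟩
  zero_mem' := ⟨0, IsWeakCurl.zero⟩
  smul_mem' := fun c _ ⟨w, hw⟩ => ⟨c • w, hw.smul c⟩

/-- The space `W^p(curl; Ω)`. It is a new type, because its norm is not the one induced
from `L^p(Ω)³`. -/
def WCurl (p : ℝ≥0∞) [Fact (1 ≤ p)] (Ω : Opens R3) : Type := wCurlSubmodule p Ω

namespace WCurl

variable {p : ℝ≥0∞} [Fact (1 ≤ p)] {Ω : Opens R3}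

instance : AddCommGroup (WCurl p Ω) := inferInstanceAs (AddCommGroup (wCurlSubmodule p Ω))

instance : Module ℝ (WCurl p Ω) := inferInstanceAs (Module ℝ (wCurlSubmodule p Ω))

/-- The inclusion of `W^p(curl; Ω)` in `L^p(Ω)³`. -/
def toLp : WCurl p Ω →ₗ[ℝ] LpField p Ω := (wCurlSubmodule p Ω).subtype

theorem toLp_injective : Function.Injective (toLp : WCurl p Ω → LpField p Ω) :=
  Subtype.val_injective

theorem exists_isWeakCurl (u : WCurl p Ω) : ∃ w : LpField p Ω, IsWeakCurl Ω (toLp u) w := u.2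

/-- The distributional curl as a linear operator `W^p(curl; Ω) → L^p(Ω)³`. -/
def curl : WCurl p Ω →ₗ[ℝ] LpField p Ω where
  toFun u := (exists_isWeakCurl u).choose
  map_add' u v := by
    refine (exists_isWeakCurl (u + v)).choose_spec.unique ?_
    rw [map_add]
    exact (exists_isWeakCurl u).choose_spec.add (exists_isWeakCurl v).choose_spec
  map_smul' c u := by
    refine (exists_isWeakCurl (c • u)).choose_spec.unique ?_
    rw [map_smul]
    exact (exists_isWeakCurl u).choose_spec.smul c

theorem isWeakCurl_curl (u : WCurl p Ω) : IsWeakCurl Ω (toLp u) (curl u) :=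
  (exists_isWeakCurl u).choose_spec

/-- The norm `‖u‖ = ‖u‖_{L^p(Ω)} + ‖curl u‖_{L^p(Ω)}` of `W^p(curl; Ω)`. -/
instance : NormedAddCommGroup (WCurl p Ω) :=
  AddGroupNorm.toNormedAddCommGroup
    { toFun := fun u => ‖toLp u‖ + ‖curl u‖
      map_zero' := by simp
      add_le' := fun u v => by
        rw [map_add, map_add]
        linarith [norm_add_le (toLp u) (toLp v), norm_add_le (curl u) (curl v)]
      neg' := fun u => by simp
      eq_zero_of_map_eq_zero' := fun u hu => by
        have h0 : ‖toLp u‖ = 0 := by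
          linarith [norm_nonneg (toLp u), norm_nonneg (curl u)]
        exact toLp_injective (by rw [norm_eq_zero.mp h0, map_zero]) }

theorem norm_def (u : WCurl p Ω) : ‖u‖ = ‖toLp u‖ + ‖curl u‖ := rfl

instance : NormedSpace ℝ (WCurl p Ω) where
  norm_smul_le c u := by
    rw [norm_def, norm_def, map_smul, map_smul, norm_smul, norm_smul, mul_add]

/-- `u` is (the class of) the vector field `φ` on `Ω`. -/
def Represents (u : WCurl p Ω) (φ : R3 → R3) : Prop :=
  toLp u =ᵐ[volume.restrict (Ω : Set R3)] φ

end WCurl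

/-- `C^∞(Ω̄)³` as a subset of `W^p(curl; Ω)`: the classes of the restrictions to `Ω` of
smooth vector fields on `ℝ³`. -/
def smoothFields (p : ℝ≥0∞) [Fact (1 ≤ p)] (Ω : Opens R3) : Set (WCurl p Ω) :=
  {u | ∃ φ : R3 → R3, ContDiff ℝ ∞ φ ∧ u.Represents φ}

end

/-!
Extend `u` and its weak curl `w` by zero outside `Ω` and convolve both with a kernel `η`. At a point
`x` the curl passes through the convolution as soon as `y ↦ η (x - y)` is supported in `Ω`, since it
is then an admissible test function. Near a boundary point the cone property of a Lipschitz domain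
gives a direction pointing into `Ω`, uniformly over the nearby points of `Ω`; kernels shrinking to
the origin inside the opposite cone look only into `Ω`, all the way up to the boundary, so that the
mollified fields and their curls converge in `L^p` near that point. The local approximations are
glued by a smooth partition of unity `χ`: the commutator terms `∇χ i × u` of the product rule cancel
in the limit because `∑ i, ∇χ i = 0` on `Ω`.
-/

open Filter Topology Set ContinuousLinearMap
open scoped Convolution

section IntegralInequalities

variable {α β F : Type*} {mα : MeasurableSpace α} {mβ : MeasurableSpace β} {μ : Measure α}
  {ν : Measure β} [NormedAddCommGroup F] {p : ℝ≥0∞}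

theorem eLpNorm_le_iff_lintegral_rpow_enorm_le (hp0 : p ≠ 0) (hp : p ≠ ⊤) {f : α → F}
    {C : ℝ≥0∞} :
    eLpNorm f p μ ≤ C ↔ ∫⁻ x, ‖f x‖ₑ ^ p.toReal ∂μ ≤ C ^ p.toReal := by
  rw [eLpNorm_eq_lintegral_rpow_enorm_toReal hp0 hp, one_div,
    ENNReal.rpow_inv_le_iff (ENNReal.toReal_pos hp0 hp)]

theorem enorm_integral_le_eLpNorm [NormedSpace ℝ F] [IsProbabilityMeasure ν] (hp1 : 1 ≤ p)
    {f : β → F} (hf : AEStronglyMeasurable f ν) : ‖∫ y, f y ∂ν‖ₑ ≤ eLpNorm f p ν :=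
  calc ‖∫ y, f y ∂ν‖ₑ
      ≤ ∫⁻ y, ‖f y‖ₑ ∂ν := enorm_integral_le_lintegral_enorm f
    _ = eLpNorm f 1 ν := eLpNorm_one_eq_lintegral_enorm.symm
    _ ≤ eLpNorm f p ν := eLpNorm_le_eLpNorm_of_exponent_le hp1 hf

theorem eLpNorm_integral_le_of_ae_eLpNorm_le [NormedSpace ℝ F] [SFinite μ]
    [IsProbabilityMeasure ν] (hp1 : 1 ≤ p) (hp : p ≠ ⊤) {f : α → β → F}
    (hf : AEStronglyMeasurable (Function.uncurry f) (μ.prod ν)) {C : ℝ≥0∞}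
    (hC : ∀ᵐ y ∂ν, eLpNorm (fun x => f x y) p μ ≤ C) :
    eLpNorm (fun x => ∫ y, f x y ∂ν) p μ ≤ C := by
  have hp0 : p ≠ 0 := (zero_lt_one.trans_le hp1).ne'
  have jensen : ∀ᵐ x ∂μ,
      ‖∫ y, f x y ∂ν‖ₑ ^ p.toReal ≤ ∫⁻ y, ‖f x y‖ₑ ^ p.toReal ∂ν := by
    filter_upwards [hf.prodMk_left] with x hx
    rw [← ENNReal.le_rpow_inv_iff (ENNReal.toReal_pos hp0 hp), ← one_div,
      ← eLpNorm_eq_lintegral_rpow_enorm_toReal hp0 hp]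
    exact enorm_integral_le_eLpNorm hp1 hx
  rw [eLpNorm_le_iff_lintegral_rpow_enorm_le hp0 hp]
  calc ∫⁻ x, ‖∫ y, f x y ∂ν‖ₑ ^ p.toReal ∂μ
      ≤ ∫⁻ x, ∫⁻ y, ‖f x y‖ₑ ^ p.toReal ∂ν ∂μ := lintegral_mono_ae jensen
    _ = ∫⁻ y, ∫⁻ x, ‖f x y‖ₑ ^ p.toReal ∂μ ∂ν :=
        lintegral_lintegral_swap (hf.enorm.pow_const _)
    _ ≤ ∫⁻ _, C ^ p.toReal ∂ν := lintegral_mono_ae <| hC.mono fun y hy =>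
        (eLpNorm_le_iff_lintegral_rpow_enorm_le hp0 hp).mp hy
    _ = C ^ p.toReal := by rw [lintegral_const, measure_univ, mul_one]

end IntegralInequalities

section TendstoELpNorm

variable {α β F G : Type*} {mα : MeasurableSpace α} {μ : Measure α} [NormedAddCommGroup F]
  [NormedAddCommGroup G] {p : ℝ≥0∞} {l : Filter β}

theorem tendsto_eLpNorm_mono_measure {ν : Measure α} (hνμ : ν ≤ μ) {f : β → α → F}
    (hf : Tendsto (fun n => eLpNorm (f n) p μ) l (𝓝 0)) :
    Tendsto (fun n => eLpNorm (f n) p ν) l (𝓝 0) :=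
  tendsto_of_tendsto_of_tendsto_of_le_of_le tendsto_const_nhds hf (fun _ => zero_le)
    fun _ => eLpNorm_mono_measure _ hνμ

theorem tendsto_eLpNorm_of_norm_le_on {s : Set α} (hs : MeasurableSet s) {f : β → α → F}
    {g : β → α → G} {C : ℝ} (hfg : ∀ n, ∀ x ∈ s, ‖f n x‖ ≤ C * ‖g n x‖)
    (hf : ∀ n, ∀ x ∉ s, f n x = 0)
    (hg : Tendsto (fun n => eLpNorm (g n) p (μ.restrict s)) l (𝓝 0)) :
    Tendsto (fun n => eLpNorm (f n) p μ) l (𝓝 0) := by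
  have hlim : Tendsto (fun n => ENNReal.ofReal C * eLpNorm (g n) p (μ.restrict s)) l (𝓝 0) := by
    simpa only [mul_zero] using ENNReal.Tendsto.const_mul hg (Or.inr ENNReal.ofReal_ne_top)
  refine tendsto_of_tendsto_of_tendsto_of_le_of_le tendsto_const_nhds hlim (fun _ => zero_le)
    fun n => ?_
  have hind : s.indicator (f n) = f n := indicator_eq_self.mpr fun x hx => by
    by_contra hxs
    exact hx (hf n x hxs)
  beta_reduce
  rw [← hind, eLpNorm_indicator_eq_eLpNorm_restrict hs]
  exact eLpNorm_le_mul_eLpNorm_of_ae_le_mul (ae_restrict_of_forall_mem hs (hfg n)) p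

theorem tendsto_eLpNorm_bilinear [NormedSpace ℝ F] [NormedSpace ℝ G] {W : Type*}
    [NormedAddCommGroup W] [NormedSpace ℝ W] [TopologicalSpace α] (B : F →L[ℝ] G →L[ℝ] W)
    {a : α → F} (ha : Continuous a) (hac : HasCompactSupport a) {s : Set α}
    (hs : MeasurableSet s) (has : tsupport a ⊆ s) {g : β → α → G}
    (hg : Tendsto (fun n => eLpNorm (g n) p (μ.restrict s)) l (𝓝 0)) :
    Tendsto (fun n => eLpNorm (fun x => B (a x) (g n x)) p μ) l (𝓝 0) := by
  obtain ⟨C, hC⟩ := hac.exists_bound_of_continuous ha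
  refine tendsto_eLpNorm_of_norm_le_on hs (C := ‖B‖ * C) (fun n x _ => ?_) (fun n x hx => ?_) hg
  · exact (B.le_opNorm₂ _ _).trans (by gcongr; exact hC x)
  · rw [image_eq_zero_of_notMem_tsupport fun h => hx (has h), map_zero, zero_apply]

theorem tendsto_eLpNorm_add (hp : 1 ≤ p) {f g : β → α → F}
    (hf : ∀ n, AEStronglyMeasurable (f n) μ) (hg : ∀ n, AEStronglyMeasurable (g n) μ)
    (hf0 : Tendsto (fun n => eLpNorm (f n) p μ) l (𝓝 0))
    (hg0 : Tendsto (fun n => eLpNorm (g n) p μ) l (𝓝 0)) :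
    Tendsto (fun n => eLpNorm (f n + g n) p μ) l (𝓝 0) :=
  tendsto_of_tendsto_of_tendsto_of_le_of_le tendsto_const_nhds
    (by simpa only [add_zero] using hf0.add hg0) (fun _ => zero_le)
    fun n => eLpNorm_add_le (hf n) (hg n) hp

theorem tendsto_eLpNorm_sum (hp : 1 ≤ p) {ι : Type*} (s : Finset ι) {f : ι → β → α → F}
    (hf : ∀ i ∈ s, ∀ n, AEStronglyMeasurable (f i n) μ)
    (hf0 : ∀ i ∈ s, Tendsto (fun n => eLpNorm (f i n) p μ) l (𝓝 0)) :
    Tendsto (fun n => eLpNorm (∑ i ∈ s, f i n) p μ) l (𝓝 0) :=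
  tendsto_of_tendsto_of_tendsto_of_le_of_le tendsto_const_nhds
    (by simpa only [Finset.sum_const_zero] using tendsto_finsetSum s hf0) (fun _ => zero_le)
    fun n => eLpNorm_sum_le (fun i hi => hf i hi n) hp

end TendstoELpNorm

section Mollification

variable {E F : Type*} [NormedAddCommGroup E] [NormedSpace ℝ E] [MeasurableSpace E]
  {μ : Measure E} [NormedAddCommGroup F] {p : ℝ≥0∞}

/-- A mollifier: a smooth compactly supported probability density with respect to `μ`. -/
structure IsMollifier (η : E → ℝ) (μ : Measure E) : Prop where
  contDiff : ContDiff ℝ ∞ η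
  hasCompactSupport : HasCompactSupport η
  nonneg : ∀ x, 0 ≤ η x
  integral_eq_one : ∫ x, η x ∂μ = 1

/-- A family of mollifiers whose supports shrink to the origin along `l`. They need not be
symmetric, nor have the origin in their support. -/
structure IsApproximateIdentity {ι : Type*} (η : ι → E → ℝ) (l : Filter ι) (μ : Measure E) :
    Prop where
  isMollifier : ∀ n, IsMollifier (η n) μ
  tendsto_support : Tendsto (fun n => Function.support (η n)) l (𝓝 0).smallSets

namespace IsMollifier

variable [BorelSpace E] {η : E → ℝ}

theorem isProbabilityMeasure_withDensity [IsFiniteMeasureOnCompacts μ]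
    (hη : IsMollifier η μ) :
    IsProbabilityMeasure (μ.withDensity fun y => ENNReal.ofReal (η y)) where
  measure_univ := by
    have hinteg : Integrable η μ :=
      hη.contDiff.continuous.integrable_of_hasCompactSupport hη.hasCompactSupport
    rw [withDensity_apply _ MeasurableSet.univ, Measure.restrict_univ,
      ← ofReal_integral_eq_lintegral_ofReal hinteg (Eventually.of_forall hη.nonneg),
      hη.integral_eq_one, ENNReal.ofReal_one]

theorem convolution_sub_apply [IsFiniteMeasureOnCompacts μ] [NormedSpace ℝ F] [CompleteSpace F]
    (hη : IsMollifier η μ) {f : E → F} {x : E}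
    (hf : ConvolutionExistsAt η f x (lsmul ℝ ℝ) μ) :
    (η ⋆[lsmul ℝ ℝ, μ] f - f) x =
      ∫ y, (f (x - y) - f x) ∂(μ.withDensity fun y => ENNReal.ofReal (η y)) := by
  have := hη.isProbabilityMeasure_withDensity
  have hmeas : Measurable fun y => ENNReal.ofReal (η y) :=
    hη.contDiff.continuous.measurable.ennreal_ofReal
  have hfin : ∀ᵐ y ∂μ, ENNReal.ofReal (η y) < ⊤ := Eventually.of_forall fun _ =>
    ENNReal.ofReal_lt_top
  have hinteg : Integrable (fun y => f (x - y)) (μ.withDensity fun y => ENNReal.ofReal (η y)) := by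
    rw [integrable_withDensity_iff_integrable_smul' hmeas hfin]
    simp only [ENNReal.toReal_ofReal (hη.nonneg _)]
    exact hf
  rw [integral_sub hinteg (integrable_const _), integral_const, probReal_univ, one_smul,
    Pi.sub_apply, convolution_lsmul, integral_withDensity_eq_integral_toReal_smul hmeas hfin]
  simp only [ENNReal.toReal_ofReal (hη.nonneg _)]

theorem eLpNorm_convolution_sub_le [FiniteDimensional ℝ E] [μ.IsAddHaarMeasure]
    [NormedSpace ℝ F] [CompleteSpace F] (hη : IsMollifier η μ) {f : E → F} (hp1 : 1 ≤ p)
    (hp : p ≠ ⊤) (hf : MemLp f p μ) {C : ℝ≥0∞}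
    (hC : ∀ y ∈ Function.support η, eLpNorm (fun x => f (x - y) - f x) p μ ≤ C) :
    eLpNorm (η ⋆[lsmul ℝ ℝ, μ] f - f) p μ ≤ C := by
  have := hη.isProbabilityMeasure_withDensity
  set ν : Measure E := μ.withDensity fun y => ENNReal.ofReal (η y) with hν
  have hmeas : AEStronglyMeasurable (fun z : E × E => f (z.1 - z.2) - f z.1) (μ.prod ν) :=
    (hf.1.comp_quasiMeasurePreserving (quasiMeasurePreserving_sub μ ν)).sub hf.1.comp_fst
  have hconv : η ⋆[lsmul ℝ ℝ, μ] f - f = fun x => ∫ y, (f (x - y) - f x) ∂ν := funext fun x =>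
    hη.convolution_sub_apply <| hη.hasCompactSupport.convolutionExists_left _
      hη.contDiff.continuous (hf.locallyIntegrable hp1) x
  rw [hconv]
  refine eLpNorm_integral_le_of_ae_eLpNorm_le hp1 hp hmeas ?_
  rw [hν, ae_withDensity_iff hη.contDiff.continuous.measurable.ennreal_ofReal]
  refine Eventually.of_forall fun y hy => hC y fun h0 => hy ?_
  rw [h0, ENNReal.ofReal_zero]

end IsMollifier

variable [BorelSpace E] [FiniteDimensional ℝ E] [μ.IsAddHaarMeasure]

theorem tendsto_eLpNorm_translate_sub {f : E → F} (hp1 : 1 ≤ p) (hp : p ≠ ⊤)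
    (hf : MemLp f p μ) :
    Tendsto (fun y => eLpNorm (fun x => f (x - y) - f x) p μ) (𝓝 0) (𝓝 0) := by
  have : Fact (1 ≤ p) := ⟨hp1⟩
  have : Fact (p ≠ ⊤) := ⟨hp⟩
  have hcont : Continuous fun y : E => DomAddAct.mk (-y) +ᵥ hf.toLp f :=
    (DomAddAct.continuous_mk.comp continuous_neg).vadd continuous_const
  have hlim := tendsto_iff_edist_tendsto_0.mp (hcont.tendsto 0)
  refine hlim.congr fun y => ?_
  rw [neg_zero, DomAddAct.mk_zero, zero_vadd, DomAddAct.mk_vadd_toLp, Lp.edist_toLp_toLp]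
  simp [neg_add_eq_sub, Pi.sub_def]

theorem IsApproximateIdentity.tendsto_eLpNorm_convolution_sub [NormedSpace ℝ F]
    [CompleteSpace F] {ι : Type*} {l : Filter ι} {η : ι → E → ℝ}
    (hη : IsApproximateIdentity η l μ) {f : E → F} (hp1 : 1 ≤ p) (hp : p ≠ ⊤)
    (hf : MemLp f p μ) :
    Tendsto (fun n => eLpNorm (η n ⋆[lsmul ℝ ℝ, μ] f - f) p μ) l (𝓝 0) := by
  rw [ENNReal.tendsto_nhds_zero]
  intro ε hε
  have htrans := ENNReal.tendsto_nhds_zero.mp (tendsto_eLpNorm_translate_sub hp1 hp hf) ε hε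
  filter_upwards [tendsto_smallSets_iff.mp hη.tendsto_support _ htrans] with n hn
  exact (hη.isMollifier n).eLpNorm_convolution_sub_le hp1 hp hf hn

theorem IsApproximateIdentity.tendsto_eLpNorm_convolution_indicator_sub [NormedSpace ℝ F]
    [CompleteSpace F] {ι : Type*} {l : Filter ι} {η : ι → E → ℝ}
    (hη : IsApproximateIdentity η l μ) {S : Set E} (hS : MeasurableSet S) {f : E → F}
    (hp1 : 1 ≤ p) (hp : p ≠ ⊤) (hf : MemLp f p (μ.restrict S)) :
    Tendsto (fun n => eLpNorm (η n ⋆[lsmul ℝ ℝ, μ] S.indicator f - f) p (μ.restrict S))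
      l (𝓝 0) := by
  have hlim : Tendsto (fun n => eLpNorm (η n ⋆[lsmul ℝ ℝ, μ] S.indicator f - S.indicator f) p μ)
      l (𝓝 0) :=
    hη.tendsto_eLpNorm_convolution_sub hp1 hp ((memLp_indicator_iff_restrict hS).mpr hf)
  refine (tendsto_eLpNorm_mono_measure Measure.restrict_le_self hlim).congr fun n =>
    eLpNorm_congr_ae ?_
  filter_upwards [indicator_ae_eq_restrict (f := f) hS] with x hx
  rw [Pi.sub_apply, Pi.sub_apply, hx]

variable (μ) in
theorem exists_isMollifier_tsupport_eq (c : E) {r : ℝ} (hr : 0 < r) :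
    ∃ η : E → ℝ, IsMollifier η μ ∧ tsupport η = Metric.closedBall c r := by
  let f : ContDiffBump c := ⟨r / 2, r, half_pos hr, half_lt_self hr⟩
  exact ⟨f.normed μ, ⟨f.contDiff_normed, f.hasCompactSupport_normed, f.nonneg_normed,
    f.integral_normed⟩, f.tsupport_normed_eq⟩

open Pointwise in
variable (μ) in
theorem exists_isApproximateIdentity_tsupport_eq (a : E) {r T : ℝ} (hr : 0 < r) (hT : 0 < T) :
    ∃ (t : ℕ → ℝ) (η : ℕ → E → ℝ), (∀ n, t n ∈ Ioo 0 T) ∧ IsApproximateIdentity η atTop μ ∧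
      ∀ n, tsupport (η n) = t n • Metric.closedBall a r := by
  obtain ⟨t, -, ht, ht0⟩ := exists_seq_strictAnti_tendsto' hT
  choose η hη hsupp using fun n =>
    exists_isMollifier_tsupport_eq μ (t n • a) (mul_pos (ht n).1 hr)
  have hsupp' : ∀ n, tsupport (η n) = t n • Metric.closedBall a r := fun n => by
    rw [hsupp, smul_closedBall _ _ hr.le, Real.norm_of_nonneg (ht n).1.le]
  refine ⟨t, η, ht, ⟨hη, tendsto_smallSets_iff.mpr fun s hs => ?_⟩, hsupp'⟩
  have hsmall : ∀ᶠ c : ℝ in 𝓝 0, c • Metric.closedBall a r ⊆ s := by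
    simpa only [singleton_zero, zero_add] using
      eventually_singleton_add_smul_subset Metric.isBounded_closedBall hs
  filter_upwards [ht0.eventually hsmall] with n hn
  exact (subset_tsupport _).trans ((hsupp' n).trans_subset hn)

end Mollification

section IntegrationByParts

variable {E F G W : Type*} [NormedAddCommGroup E] [MeasurableSpace E] [BorelSpace E]
  {μ : Measure E} [NormedAddCommGroup F] [NormedSpace ℝ F]
  [NormedAddCommGroup G] [NormedSpace ℝ G] [NormedAddCommGroup W] [NormedSpace ℝ W]

theorem integrable_bilinear_of_hasCompactSupport_right [IsFiniteMeasureOnCompacts μ]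
    (B : F →L[ℝ] G →L[ℝ] W) {f : E → F} {g : E → G} (hf : Continuous f) (hg : Continuous g)
    (hgc : HasCompactSupport g) : Integrable (fun x => B (f x) (g x)) μ := by
  refine Continuous.integrable_of_hasCompactSupport (by fun_prop) (hgc.mono fun x hx hgx => hx ?_)
  beta_reduce
  rw [hgx, map_zero]

theorem integral_bilinear_fderiv_left_eq_neg [NormedSpace ℝ E] [FiniteDimensional ℝ E]
    [μ.IsAddHaarMeasure] (B : F →L[ℝ] G →L[ℝ] W) {f : E → F} {g : E → G}
    (hf : ContDiff ℝ 1 f) (hg : ContDiff ℝ 1 g) (hgc : HasCompactSupport g) (v : E) :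
    ∫ x, B (fderiv ℝ f x v) (g x) ∂μ = -∫ x, B (f x) (fderiv ℝ g x v) ∂μ := by
  have hf' : Continuous fun x => fderiv ℝ f x v :=
    (hf.continuous_fderiv one_ne_zero).clm_apply continuous_const
  have hg' : Continuous fun x => fderiv ℝ g x v :=
    (hg.continuous_fderiv one_ne_zero).clm_apply continuous_const
  rw [integral_bilinear_fderiv_right_eq_neg_left_of_integrable
    (integrable_bilinear_of_hasCompactSupport_right B hf' hg.continuous hgc)
    (integrable_bilinear_of_hasCompactSupport_right B hf.continuous hg' (hgc.fderiv_apply ℝ v))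
    (integrable_bilinear_of_hasCompactSupport_right B hf.continuous hg.continuous hgc)
    (fun x _ => hf.differentiable one_ne_zero x) (fun x _ => hg.differentiable one_ne_zero x),
    neg_neg]

end IntegrationByParts

theorem setIntegral_inner_eq_integral {α F : Type*} [TopologicalSpace α] [MeasurableSpace α]
    {μ : Measure α} [NormedAddCommGroup F] [InnerProductSpace ℝ F] {S : Set α} {φ : α → F}
    (hφ : tsupport φ ⊆ S) (f : α → F) :
    ∫ x in S, ⟪f x, φ x⟫_ℝ ∂μ = ∫ x, ⟪f x, φ x⟫_ℝ ∂μ :=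
  setIntegral_eq_integral_of_forall_compl_eq_zero fun x hx => by
    rw [image_eq_zero_of_notMem_tsupport fun h => hx (hφ h), inner_zero_right]

section Curl

/-- The curl as a linear function of the Jacobian. -/
noncomputable def curlOfJacobian : (R3 →L[ℝ] R3) →L[ℝ] R3 :=
  LinearMap.toContinuousLinearMap
    { toFun := fun A =>
        !₂[A (EuclideanSpace.single 1 1) 2 - A (EuclideanSpace.single 2 1) 1,
           A (EuclideanSpace.single 2 1) 0 - A (EuclideanSpace.single 0 1) 2,
           A (EuclideanSpace.single 0 1) 1 - A (EuclideanSpace.single 1 1) 0]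
      map_add' := fun A B => by
        ext i
        fin_cases i <;> simp <;> ring
      map_smul' := fun c A => by
        ext i
        fin_cases i <;> simp <;> ring }

/-- The cross product `l♯ × a`, where `l♯` is the vector representing the linear form `l`. Applied
to the derivative of a scalar function it gives the terms `∇χ × a` of the product rule. -/
noncomputable def covectorCross : (R3 →L[ℝ] ℝ) →L[ℝ] R3 →L[ℝ] R3 :=
  compL ℝ R3 (R3 →L[ℝ] R3) R3 curlOfJacobian ∘L smulRightL ℝ R3 R3

theorem covectorCross_apply (l : R3 →L[ℝ] ℝ) (a : R3) :
    covectorCross l a = curlOfJacobian (l.smulRight a) := rfl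

theorem inner_covectorCross_right (l : R3 →L[ℝ] ℝ) (a b : R3) :
    ⟪a, covectorCross l b⟫_ℝ = -⟪covectorCross l a, b⟫_ℝ := by
  simp only [covectorCross_apply, curlOfJacobian, LinearMap.coe_toContinuousLinearMap',
    LinearMap.coe_mk, AddHom.coe_mk, smulRight_apply, PiLp.smul_apply, smul_eq_mul,
    PiLp.inner_apply, RCLike.inner_apply, Real.ringHom_apply, Fin.sum_univ_three,
    Matrix.cons_val_zero, Matrix.cons_val_one, Matrix.cons_val]
  ring

theorem curlOfJacobian_eq_sum (A : R3 →L[ℝ] R3) :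
    curlOfJacobian A =
      ∑ i, covectorCross (EuclideanSpace.proj i) (A (EuclideanSpace.single i 1)) := by
  simp only [covectorCross_apply, ← map_sum]
  congr 1
  ext x : 1
  have hx : x = ∑ i, x i • EuclideanSpace.single i (1 : ℝ) := by
    simpa using ((EuclideanSpace.basisFun (Fin 3) ℝ).sum_repr x).symm
  conv_lhs => rw [hx]
  simp [map_sum]

theorem classicalCurl_eq_curlOfJacobian_fderiv (φ : R3 → R3) (x : R3) :
    classicalCurl φ x = curlOfJacobian (fderiv ℝ φ x) := rfl

theorem tsupport_classicalCurl_subset (φ : R3 → R3) :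
    tsupport (classicalCurl φ) ⊆ tsupport φ :=
  (tsupport_comp_subset (map_zero curlOfJacobian) (fderiv ℝ φ)).trans (tsupport_fderiv_subset ℝ)

theorem classicalCurl_fun_smul {χ : R3 → ℝ} {g : R3 → R3} {x : R3}
    (hχ : DifferentiableAt ℝ χ x) (hg : DifferentiableAt ℝ g x) :
    classicalCurl (fun y => χ y • g y) x =
      χ x • classicalCurl g x + covectorCross (fderiv ℝ χ x) (g x) := by
  simp only [classicalCurl_eq_curlOfJacobian_fderiv, fderiv_fun_smul hχ hg, map_add, map_smul,
    covectorCross_apply]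

theorem classicalCurl_fun_sum {ι : Type*} {s : Finset ι} {g : ι → R3 → R3} {x : R3}
    (hg : ∀ i ∈ s, DifferentiableAt ℝ (g i) x) :
    classicalCurl (fun y => ∑ i ∈ s, g i y) x = ∑ i ∈ s, classicalCurl (g i) x := by
  simp only [classicalCurl_eq_curlOfJacobian_fderiv, fderiv_fun_sum hg, map_sum]

theorem integral_inner_classicalCurl_left {ψ φ : R3 → R3} (hψ : ContDiff ℝ 1 ψ)
    (hφ : ContDiff ℝ 1 φ) (hφc : HasCompactSupport φ) :
    ∫ x, ⟪classicalCurl ψ x, φ x⟫_ℝ = ∫ x, ⟪ψ x, classicalCurl φ x⟫_ℝ := by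
  let e : Fin 3 → R3 := fun i => EuclideanSpace.single i 1
  let B : Fin 3 → R3 →L[ℝ] R3 →L[ℝ] ℝ := fun i =>
    innerSL ℝ ∘L covectorCross (EuclideanSpace.proj i)
  have hψ' : ∀ i, Continuous fun x => fderiv ℝ ψ x (e i) := fun i =>
    (hψ.continuous_fderiv one_ne_zero).clm_apply continuous_const
  have hφ' : ∀ i, Continuous fun x => fderiv ℝ φ x (e i) := fun i =>
    (hφ.continuous_fderiv one_ne_zero).clm_apply continuous_const
  calc ∫ x, ⟪classicalCurl ψ x, φ x⟫_ℝ
      = ∫ x, ∑ i, B i (fderiv ℝ ψ x (e i)) (φ x) := by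
        simp only [classicalCurl_eq_curlOfJacobian_fderiv, curlOfJacobian_eq_sum, sum_inner]
        rfl
    _ = ∑ i, ∫ x, B i (fderiv ℝ ψ x (e i)) (φ x) := integral_finsetSum _ fun i _ =>
        integrable_bilinear_of_hasCompactSupport_right (B i) (hψ' i) hφ.continuous hφc
    _ = ∑ i, ∫ x, -B i (ψ x) (fderiv ℝ φ x (e i)) := by
        simp only [integral_bilinear_fderiv_left_eq_neg _ hψ hφ hφc, integral_neg]
    _ = ∫ x, ∑ i, -B i (ψ x) (fderiv ℝ φ x (e i)) := .symm <| integral_finsetSum _ fun i _ =>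
        (integrable_bilinear_of_hasCompactSupport_right (B i) hψ.continuous (hφ' i)
          (hφc.fderiv_apply ℝ (e i))).neg
    _ = ∫ x, ⟪ψ x, classicalCurl φ x⟫_ℝ := by
        simp only [classicalCurl_eq_curlOfJacobian_fderiv, curlOfJacobian_eq_sum, inner_sum,
          inner_covectorCross_right]
        rfl

theorem isWeakCurl_classicalCurl (Ω : Opens R3) {ψ : R3 → R3} (hψ : ContDiff ℝ 1 ψ) :
    IsWeakCurl Ω ψ (classicalCurl ψ) := by
  intro φ hφ
  rw [setIntegral_inner_eq_integral hφ.tsupport_subset,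
    setIntegral_inner_eq_integral ((tsupport_classicalCurl_subset φ).trans hφ.tsupport_subset),
    integral_inner_classicalCurl_left hψ (hφ.contDiff.of_le (by simp)) hφ.hasCompactSupport]

end Curl

section Convolution

theorem inner_convolution_lsmul {E F : Type*} [NormedAddCommGroup E] [MeasurableSpace E]
    [MeasurableAdd E] [MeasurableNeg E] {μ : Measure E} [μ.IsAddLeftInvariant]
    [μ.IsNegInvariant] [NormedAddCommGroup F] [InnerProductSpace ℝ F] [CompleteSpace F]
    {η : E → ℝ} {f : E → F} {x : E} (hf : ConvolutionExistsAt η f x (lsmul ℝ ℝ) μ) (v : F) :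
    ⟪(η ⋆[lsmul ℝ ℝ, μ] f) x, v⟫_ℝ = ∫ y, ⟪f y, η (x - y) • v⟫_ℝ ∂μ := by
  rw [convolution_lsmul, real_inner_comm, ← integral_inner (f := fun y => η y • f (x - y)) hf,
    ← integral_sub_left_eq_self (fun y => ⟪f y, η (x - y) • v⟫_ℝ) μ x]
  congr 1 with y
  rw [sub_sub_cancel, inner_smul_right, inner_smul_right, real_inner_comm]

variable {η : R3 → ℝ} {f : R3 → R3}

theorem classicalCurl_convolution_eq_integral (hη : ContDiff ℝ 1 η) (hc : HasCompactSupport η)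
    (hf : LocallyIntegrable f) (x : R3) :
    classicalCurl (η ⋆[lsmul ℝ ℝ, volume] f) x =
      ∫ y, covectorCross (fderiv ℝ η y) (f (x - y)) := by
  have hinteg : Integrable fun y => (fderiv ℝ η y).smulRight (f (x - y)) :=
    (hc.fderiv ℝ).convolutionExists_left
      (precompL R3 (lsmul ℝ ℝ : ℝ →L[ℝ] R3 →L[ℝ] R3)) (hη.continuous_fderiv one_ne_zero) hf x
  rw [classicalCurl_eq_curlOfJacobian_fderiv,
    (hc.hasFDerivAt_convolution_left _ hη hf x).fderiv]
  exact (curlOfJacobian.integral_comp_comm hinteg).symm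

theorem classicalCurl_comp_sub_left_smul_const (hη : Differentiable ℝ η) (x v y : R3) :
    classicalCurl (fun y => η (x - y) • v) y = -covectorCross (fderiv ℝ η (x - y)) v := by
  have hη' : HasFDerivAt (fun y => η (x - y)) (-fderiv ℝ η (x - y)) y := by
    simpa only [comp_neg, comp_id] using!
      (hη (x - y)).hasFDerivAt.comp y ((hasFDerivAt_id y).const_sub x)
  rw [classicalCurl_eq_curlOfJacobian_fderiv, (hη'.smul_const v).fderiv, ← covectorCross_apply,
    map_neg, neg_apply]

theorem inner_classicalCurl_convolution (hη : ContDiff ℝ 1 η) (hc : HasCompactSupport η)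
    (hf : LocallyIntegrable f) (x v : R3) :
    ⟪classicalCurl (η ⋆[lsmul ℝ ℝ, volume] f) x, v⟫_ℝ =
      ∫ y, ⟪f y, classicalCurl (fun y => η (x - y) • v) y⟫_ℝ := by
  have hinteg : Integrable fun y => covectorCross (fderiv ℝ η y) (f (x - y)) :=
    (hc.fderiv ℝ).convolutionExists_left covectorCross (hη.continuous_fderiv one_ne_zero) hf x
  rw [classicalCurl_convolution_eq_integral hη hc hf, real_inner_comm, ← integral_inner hinteg,
    ← integral_sub_left_eq_self (fun y => ⟪f y, classicalCurl (fun y => η (x - y) • v) y⟫_ℝ)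
      volume x]
  congr 1 with y
  rw [classicalCurl_comp_sub_left_smul_const (hη.differentiable one_ne_zero), sub_sub_cancel,
    inner_neg_right, real_inner_comm, inner_covectorCross_right, neg_neg]

theorem isTestField_comp_sub_left_smul_const {Ω : Opens R3} (hη : ContDiff ℝ ∞ η)
    (hc : HasCompactSupport η) {x : R3} (hx : ∀ y ∈ tsupport η, x - y ∈ Ω) (v : R3) :
    IsTestField Ω fun y => η (x - y) • v where
  contDiff := by fun_prop
  hasCompactSupport := (hc.comp_homeomorph (Homeomorph.subLeft x)).smul_right
  tsupport_subset y hy := by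
    have hxy : x - y ∈ tsupport η := tsupport_comp_subset_preimage η
      (continuous_const.sub continuous_id) (closure_mono (Function.support_smul_subset_left _ _) hy)
    exact sub_sub_cancel x y ▸ hx _ hxy

theorem IsWeakCurl.classicalCurl_convolution {Ω : Opens R3} {u w : R3 → R3}
    (h : IsWeakCurl Ω u w) (hη : ContDiff ℝ ∞ η) (hc : HasCompactSupport η)
    (hu : LocallyIntegrable ((Ω : Set R3).indicator u))
    (hw : LocallyIntegrable ((Ω : Set R3).indicator w)) {x : R3}
    (hx : ∀ y ∈ tsupport η, x - y ∈ Ω) :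
    classicalCurl (η ⋆[lsmul ℝ ℝ, volume] (Ω : Set R3).indicator u) x =
      (η ⋆[lsmul ℝ ℝ, volume] (Ω : Set R3).indicator w) x := by
  have hind (a b : R3 → R3) :
      ∫ y, ⟪(Ω : Set R3).indicator a y, b y⟫_ℝ = ∫ y in (Ω : Set R3), ⟪a y, b y⟫_ℝ := by
    rw [← integral_indicator Ω.isOpen.measurableSet]
    congr 1 with y
    by_cases hy : y ∈ (Ω : Set R3) <;> simp [hy]
  refine ext_inner_right ℝ fun v => ?_
  rw [inner_classicalCurl_convolution (hη.of_le (by simp)) hc hu,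
    inner_convolution_lsmul (hc.convolutionExists_left _ hη.continuous hw x), hind, hind,
    h _ (isTestField_comp_sub_left_smul_const hη hc hx v)]

end Convolution

section InwardCone

variable {E : Type*} [NormedAddCommGroup E] [NormedSpace ℝ E]

/-- The (one-sided, local) uniform cone property of `Ω` at `z`: for some direction `a`, every short
displacement `t • b` with `t > 0` and `b` close to `a` carries the points of `Ω` near `z`
into `Ω`. -/
def HasInwardConeAt (Ω : Set E) (z : E) : Prop :=
  ∃ a : E, ∀ᶠ q : E × ℝ × E in 𝓝[Ω] z ×ˢ 𝓝[>] 0 ×ˢ 𝓝 a, q.1 + q.2.1 • q.2.2 ∈ Ω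

theorem HasInwardConeAt.of_eventually {Ω V : Set E} {z a : E} (hV : V ∈ 𝓝 z)
    (h : ∀ᶠ b in 𝓝 a, ∀ x ∈ Ω ∩ V, ∀ t > (0 : ℝ), x + t • b ∈ V → x + t • b ∈ Ω) :
    HasInwardConeAt Ω z := by
  have hcont : Tendsto (fun q : E × ℝ × E => q.1 + q.2.1 • q.2.2) (𝓝 (z, 0, a)) (𝓝 z) := by
    refine Continuous.tendsto' (by fun_prop) _ _ ?_
    rw [zero_smul, add_zero]
  have hle : 𝓝[Ω] z ×ˢ 𝓝[>] (0 : ℝ) ×ˢ 𝓝 a ≤ 𝓝 (z, 0, a) := by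
    rw [nhds_prod_eq, nhds_prod_eq]
    exact prod_mono nhdsWithin_le_nhds (prod_mono nhdsWithin_le_nhds le_rfl)
  have hbase : ∀ᶠ x in 𝓝[Ω] z, x ∈ Ω ∩ V :=
    inter_mem self_mem_nhdsWithin (mem_nhdsWithin_of_mem_nhds hV)
  refine ⟨a, ?_⟩
  filter_upwards [(hcont.mono_left hle).eventually hV,
    hbase.prod_mk (eventually_mem_nhdsWithin.prod_mk h)] with q hqV ⟨hx, ht, hb⟩
  exact hb q.1 hx q.2.1 ht hqV

theorem hasInwardConeAt_of_mem {Ω : Set E} (hΩ : IsOpen Ω) {z : E} (hz : z ∈ Ω) :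
    HasInwardConeAt Ω z :=
  .of_eventually (a := 0) (hΩ.mem_nhds hz) (Eventually.of_forall fun _ _ _ _ _ h => h)

theorem HasInwardConeAt.exists_isApproximateIdentity [FiniteDimensional ℝ E] [MeasurableSpace E]
    [BorelSpace E] (μ : Measure E) [μ.IsAddHaarMeasure] {Ω : Set E} {z : E}
    (h : HasInwardConeAt Ω z) :
    ∃ U, IsOpen U ∧ z ∈ U ∧ ∃ η : ℕ → E → ℝ, IsApproximateIdentity η atTop μ ∧
      ∀ n, ∀ x ∈ Ω ∩ U, ∀ y ∈ tsupport (η n), x - y ∈ Ω := by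
  obtain ⟨a, ha⟩ := h
  obtain ⟨⟨s, T, r⟩, ⟨hs, hT, hr⟩, hcone⟩ := ((basis_sets (𝓝[Ω] z)).prod
    ((nhdsGT_basis (0 : ℝ)).prod (Metric.nhds_basis_closedBall (x := a)))).eventually_iff.mp ha
  obtain ⟨U, hU, hzU, hUs⟩ := mem_nhdsWithin.mp hs
  obtain ⟨t, η, ht, hη, hsupp⟩ := exists_isApproximateIdentity_tsupport_eq μ (-a) hr hT
  refine ⟨U, hU, hzU, η, hη, fun n x hx y hy => ?_⟩
  obtain ⟨b, hb, rfl⟩ := (hsupp n).subset hy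
  have hb' : -b ∈ Metric.closedBall a r := by
    rwa [mem_closedBall_iff_norm, ← norm_neg, neg_sub, sub_neg_eq_add, add_comm, ← sub_neg_eq_add,
      ← mem_closedBall_iff_norm]
  have hmem := hcone (x := (x, t n, -b)) ⟨hUs ⟨hx.2, hx.1⟩, ht n, hb'⟩
  simpa only [smul_neg, ← sub_eq_add_neg] using hmem

end InwardCone

section LipschitzBoundary

theorem apply_add_lt_add_of_lipschitzWith {E : Type*} [SeminormedAddCommGroup E] {K : NNReal}
    {h : E → ℝ} (hh : LipschitzWith K h) {x y : E} {s τ : ℝ} (hx : h x < s) (hy : K * ‖y‖ ≤ τ) :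
    h (x + y) < s + τ := by
  have hdist : h (x + y) - h x ≤ K * ‖y‖ := by
    simpa only [dist_eq_norm, add_sub_cancel_left] using
      (le_abs_self _).trans (hh.dist_le_mul (x + y) x)
  linarith

theorem HasLipschitzBoundary.hasInwardConeAt {Ω : Set R3} (hΩ : IsOpen Ω)
    (hLip : HasLipschitzBoundary Ω) {z : R3} (hz : z ∈ closure Ω) : HasInwardConeAt Ω z := by
  by_cases hzΩ : z ∈ Ω
  · exact hasInwardConeAt_of_mem hΩ hzΩ
  obtain ⟨V, hVo, hzV, e, K, h, hh, hV⟩ := hLip z ⟨hz, by rwa [hΩ.interior_eq]⟩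
  let up : R3 := e.symm (EuclideanSpace.single 2 1)
  have hsteep : ∀ᶠ b in 𝓝 up, (K : ℝ) * ‖!₂[e b 0, e b 1]‖ < e b 2 := by
    have hcont : Continuous fun b => !₂[e b 0, e b 1] :=
      (PiLp.continuous_toLp 2 _).comp (by fun_prop)
    refine (continuous_const.mul hcont.norm).continuousAt.eventually_lt (by fun_prop) ?_
    simp [up, EuclideanSpace.norm_eq]
  refine .of_eventually (hVo.mem_nhds hzV) (hsteep.mono fun b hb x hx t ht hxtV => ?_)
  have hadd : (!₂[e (x + t • b) 0, e (x + t • b) 1] : EuclideanSpace ℝ (Fin 2)) =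
      !₂[e x 0, e x 1] + t • !₂[e b 0, e b 1] := by
    ext i
    fin_cases i <;> simp
  rw [hV _ hxtV, hadd, map_add, map_smul, PiLp.add_apply, PiLp.smul_apply, smul_eq_mul]
  refine apply_add_lt_add_of_lipschitzWith hh ((hV x hx.2).mp hx.1) ?_
  rw [norm_smul, Real.norm_of_nonneg ht.le, mul_left_comm]
  exact mul_le_mul_of_nonneg_left hb.le ht.le

end LipschitzBoundary

theorem exists_finite_smooth_partition {E : Type*} [NormedAddCommGroup E] [NormedSpace ℝ E]
    [FiniteDimensional ℝ E] {K : Set E} (hK : IsCompact K) {U : E → Set E}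
    (hU : ∀ z ∈ K, U z ∈ 𝓝 z) :
    ∃ (t : Finset E) (χ : t → E → ℝ), (∀ i : t, (i : E) ∈ K ∧ tsupport (χ i) ⊆ U i) ∧
      (∀ i, ContDiff ℝ ∞ (χ i)) ∧ (∀ i, HasCompactSupport (χ i)) ∧ ∀ x ∈ K, ∑ i, χ i x = 1 := by
  let U' : E → Set E := fun z => interior (U z) ∩ Metric.ball z 1
  obtain ⟨t, htK, ht⟩ := hK.elim_nhds_subcover U' fun z hz =>
    inter_mem (interior_mem_nhds.mpr (hU z hz)) (Metric.ball_mem_nhds z one_pos)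
  obtain ⟨χ, hχ⟩ := SmoothPartitionOfUnity.exists_isSubordinate (ι := t)
    (modelWithCornersSelf ℝ E) hK.isClosed (fun i => U' i)
    (fun i => isOpen_interior.inter Metric.isOpen_ball)
    (ht.trans_eq (biUnion_eq_iUnion _ _))
  refine ⟨t, fun i => χ i, fun i => ⟨htK i i.2, ?_⟩, fun i => ?_, fun i => ?_, fun x hx => ?_⟩
  · exact (hχ i).trans (inter_subset_left.trans interior_subset)
  · exact contMDiff_iff_contDiff.mp (χ i).contMDiff
  · exact (isCompact_closedBall (i : E) 1).of_isClosed_subset (isClosed_tsupport _)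
      ((hχ i).trans (inter_subset_right.trans Metric.ball_subset_closedBall))
  · rw [← finsum_eq_sum_of_fintype]
    exact χ.sum_eq_one hx

theorem sum_fderiv_eq_zero_of_sum_eq_one {ι E : Type*} [Fintype ι] [NormedAddCommGroup E]
    [NormedSpace ℝ E] {χ : ι → E → ℝ} {S : Set E} (hS : IsOpen S) {x : E} (hx : x ∈ S)
    (hχ : ∀ i, DifferentiableAt ℝ (χ i) x) (hsum : ∀ y ∈ S, ∑ i, χ i y = 1) :
    ∑ i, fderiv ℝ (χ i) x = 0 := by
  have hconst : (fun y => ∑ i, χ i y) =ᶠ[𝓝 x] fun _ => 1 :=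
    (hS.eventually_mem hx).mono hsum
  rw [← fderiv_fun_sum fun i _ => hχ i, hconst.fderiv_eq, fderiv_fun_const, Pi.zero_apply]

section StrongCurl

variable {p : ℝ≥0∞} {S : Set R3} {u w : R3 → R3}

/-- `w` is the strong `L^p` curl of `u` on `S`: there are smooth fields on `ℝ³` converging to `u`
in `L^p(S)` whose curls converge to `w` in `L^p(S)`. -/
def IsStrongCurl (p : ℝ≥0∞) (S : Set R3) (u w : R3 → R3) : Prop :=
  ∃ v : ℕ → R3 → R3, (∀ n, ContDiff ℝ ∞ (v n)) ∧
    Tendsto (fun n => eLpNorm (v n - u) p (volume.restrict S)) atTop (𝓝 0) ∧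
    Tendsto (fun n => eLpNorm (classicalCurl (v n) - w) p (volume.restrict S)) atTop (𝓝 0)

namespace IsStrongCurl

theorem mono {T : Set R3} (h : IsStrongCurl p T u w) (hST : S ⊆ T) : IsStrongCurl p S u w := by
  obtain ⟨v, hv, hvu, hvw⟩ := h
  have hle := Measure.restrict_mono_set (volume : Measure R3) hST
  exact ⟨v, hv, tendsto_eLpNorm_mono_measure hle hvu, tendsto_eLpNorm_mono_measure hle hvw⟩

theorem congr {u' w' : R3 → R3} (h : IsStrongCurl p S u w) (hS : MeasurableSet S)
    (hu : EqOn u u' S) (hw : EqOn w w' S) : IsStrongCurl p S u' w' := by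
  obtain ⟨v, hv, hvu, hvw⟩ := h
  exact ⟨v, hv,
    hvu.congr fun _ => eLpNorm_congr_ae (EventuallyEq.rfl.sub (ae_restrict_of_forall_mem hS hu)),
    hvw.congr fun _ => eLpNorm_congr_ae (EventuallyEq.rfl.sub (ae_restrict_of_forall_mem hS hw))⟩

theorem smul {χ : R3 → ℝ} (h : IsStrongCurl p (S ∩ tsupport χ) u w) (hp : 1 ≤ p)
    (hu : AEStronglyMeasurable u (volume.restrict S))
    (hw : AEStronglyMeasurable w (volume.restrict S)) (hχ : ContDiff ℝ ∞ χ)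
    (hχc : HasCompactSupport χ) :
    IsStrongCurl p S (fun x => χ x • u x)
      fun x => χ x • w x + covectorCross (fderiv ℝ χ x) (u x) := by
  obtain ⟨v, hv, hvu, hvw⟩ := h
  have hs : MeasurableSet (tsupport χ) := (isClosed_tsupport χ).measurableSet
  rw [inter_comm, ← Measure.restrict_restrict hs] at hvu hvw
  have hχ' : Continuous (fderiv ℝ χ) := hχ.continuous_fderiv (by simp)
  have hvu_meas : ∀ n, AEStronglyMeasurable (v n - u) (volume.restrict S) := fun n =>
    (hv n).continuous.aestronglyMeasurable.sub hu
  have hvw_meas : ∀ n, AEStronglyMeasurable (classicalCurl (v n) - w) (volume.restrict S) :=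
    fun n => (continuous_classicalCurl (hv n)).aestronglyMeasurable.sub hw
  have hscal : Tendsto (fun n => eLpNorm (fun x => χ x • (classicalCurl (v n) - w) x) p
      (volume.restrict S)) atTop (𝓝 0) :=
    tendsto_eLpNorm_bilinear (lsmul ℝ ℝ) hχ.continuous hχc hs subset_rfl hvw
  have hcross : Tendsto (fun n => eLpNorm (fun x => covectorCross (fderiv ℝ χ x) ((v n - u) x)) p
      (volume.restrict S)) atTop (𝓝 0) :=
    tendsto_eLpNorm_bilinear covectorCross hχ' (hχc.fderiv ℝ) hs (tsupport_fderiv_subset ℝ) hvu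
  refine ⟨fun n x => χ x • v n x, fun n => hχ.smul (hv n), ?_, ?_⟩
  · refine (tendsto_eLpNorm_bilinear (lsmul ℝ ℝ) hχ.continuous hχc hs subset_rfl hvu).congr
      fun n => congrArg (eLpNorm · p _) (funext fun x => ?_)
    simp only [lsmul_apply, Pi.sub_apply, smul_sub]
  · refine (tendsto_eLpNorm_add hp
      (fun n => hχ.continuous.aestronglyMeasurable.smul (hvw_meas n))
      (fun n => covectorCross.aestronglyMeasurable_comp₂ hχ'.aestronglyMeasurable (hvu_meas n))
      hscal hcross).congr fun n => congrArg (eLpNorm · p _) (funext fun x => ?_)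
    rw [Pi.sub_apply, classicalCurl_fun_smul (hχ.differentiable (by simp) x)
      ((hv n).differentiable (by simp) x)]
    simp only [Pi.add_apply, Pi.smul_apply', Pi.sub_apply, smul_sub, map_sub]
    abel

theorem sum {ι : Type*} (s : Finset ι) {u w : ι → R3 → R3} (hp : 1 ≤ p)
    (hu : ∀ i ∈ s, AEStronglyMeasurable (u i) (volume.restrict S))
    (hw : ∀ i ∈ s, AEStronglyMeasurable (w i) (volume.restrict S))
    (h : ∀ i, IsStrongCurl p S (u i) (w i)) :
    IsStrongCurl p S (fun x => ∑ i ∈ s, u i x) fun x => ∑ i ∈ s, w i x := by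
  choose v hv hvu hvw using h
  refine ⟨fun n x => ∑ i ∈ s, v i n x, fun n => ContDiff.sum fun i _ => hv i n, ?_, ?_⟩
  · refine (tendsto_eLpNorm_sum hp s (fun i hi n =>
      (hv i n).continuous.aestronglyMeasurable.sub (hu i hi)) fun i _ => hvu i).congr
      fun n => congrArg (eLpNorm · p _) (funext fun x => ?_)
    simp only [Finset.sum_apply, Pi.sub_apply, Finset.sum_sub_distrib]
  · refine (tendsto_eLpNorm_sum hp s (fun i hi n =>
      (continuous_classicalCurl (hv i n)).aestronglyMeasurable.sub (hw i hi)) fun i _ =>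
      hvw i).congr fun n => congrArg (eLpNorm · p _) (funext fun x => ?_)
    rw [Pi.sub_apply, classicalCurl_fun_sum fun i _ => (hv i n).differentiable (by simp) x]
    simp only [Finset.sum_apply, Pi.sub_apply, Finset.sum_sub_distrib]

theorem of_locally (hS : IsOpen S) (hbdd : Bornology.IsBounded S) (hp : 1 ≤ p)
    (hu : AEStronglyMeasurable u (volume.restrict S))
    (hw : AEStronglyMeasurable w (volume.restrict S))
    (h : ∀ z ∈ closure S, ∃ U ∈ 𝓝 z, IsStrongCurl p (S ∩ U) u w) : IsStrongCurl p S u w := by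
  choose! U hU hUu using h
  obtain ⟨t, χ, hχU, hχ, hχc, hsum⟩ := exists_finite_smooth_partition hbdd.isCompact_closure hU
  have hsum' : ∀ x ∈ S, ∑ i, χ i x = 1 := fun x hx => hsum x (subset_closure hx)
  have hlocal : ∀ i, IsStrongCurl p S (fun x => χ i x • u x)
      fun x => χ i x • w x + covectorCross (fderiv ℝ (χ i) x) (u x) := fun i =>
    ((hUu i (hχU i).1).mono (inter_subset_inter_right S (hχU i).2)).smul hp hu hw (hχ i) (hχc i)
  have hscal : ∀ i {f : R3 → R3}, AEStronglyMeasurable f (volume.restrict S) →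
      AEStronglyMeasurable (fun x => χ i x • f x) (volume.restrict S) := fun i _ hf =>
    (hχ i).continuous.aestronglyMeasurable.smul hf
  have hcross : ∀ i, AEStronglyMeasurable (fun x => covectorCross (fderiv ℝ (χ i) x) (u x))
      (volume.restrict S) := fun i =>
    covectorCross.aestronglyMeasurable_comp₂
      ((hχ i).continuous_fderiv (by simp)).aestronglyMeasurable hu
  refine (sum Finset.univ hp (fun i _ => hscal i hu) (fun i _ => (hscal i hw).add (hcross i))
    hlocal).congr hS.measurableSet (fun x hx => ?_) fun x hx => ?_
  · simp only [← Finset.sum_smul, hsum' x hx, one_smul]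
  · have hgrad : ∑ i, fderiv ℝ (χ i) x = 0 := sum_fderiv_eq_zero_of_sum_eq_one hS hx
      (fun i => (hχ i).differentiable (by simp) x) hsum'
    simp only [Pi.add_apply, Finset.sum_add_distrib, ← Finset.sum_smul, hsum' x hx, one_smul,
      ← sum_apply, ← map_sum, hgrad, map_zero, zero_apply, add_zero]

end IsStrongCurl

theorem IsWeakCurl.exists_isStrongCurl_inter {Ω : Opens R3} (h : IsWeakCurl Ω u w)
    (hp1 : 1 ≤ p) (hp : p ≠ ⊤) (hu : MemLp u p (volume.restrict (Ω : Set R3)))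
    (hw : MemLp w p (volume.restrict (Ω : Set R3))) {z : R3}
    (hz : HasInwardConeAt (Ω : Set R3) z) : ∃ U ∈ 𝓝 z, IsStrongCurl p (Ω ∩ U) u w := by
  have hΩ : MeasurableSet (Ω : Set R3) := Ω.isOpen.measurableSet
  obtain ⟨U, hU, hzU, η, hη, hwindow⟩ := hz.exists_isApproximateIdentity volume
  have hu_loc : LocallyIntegrable ((Ω : Set R3).indicator u) :=
    ((memLp_indicator_iff_restrict hΩ).mpr hu).locallyIntegrable hp1
  have hw_loc : LocallyIntegrable ((Ω : Set R3).indicator w) :=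
    ((memLp_indicator_iff_restrict hΩ).mpr hw).locallyIntegrable hp1
  have hle : volume.restrict ((Ω : Set R3) ∩ U) ≤ volume.restrict (Ω : Set R3) :=
    Measure.restrict_mono_set volume inter_subset_left
  refine ⟨U, hU.mem_nhds hzU,
    fun n => η n ⋆[lsmul ℝ ℝ, volume] (Ω : Set R3).indicator u, fun n => ?_, ?_, ?_⟩
  · exact (hη.isMollifier n).hasCompactSupport.contDiff_convolution_left _
      (hη.isMollifier n).contDiff hu_loc
  · exact tendsto_eLpNorm_mono_measure hle
      (hη.tendsto_eLpNorm_convolution_indicator_sub hΩ hp1 hp hu)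
  · refine (tendsto_eLpNorm_mono_measure hle
      (hη.tendsto_eLpNorm_convolution_indicator_sub hΩ hp1 hp hw)).congr fun n =>
      eLpNorm_congr_ae (EventuallyEq.sub ?_ EventuallyEq.rfl)
    refine ae_restrict_of_forall_mem (hΩ.inter hU.measurableSet) fun x hx => ?_
    exact (h.classicalCurl_convolution (hη.isMollifier n).contDiff
      (hη.isMollifier n).hasCompactSupport hu_loc hw_loc (hwindow n x hx)).symm

theorem IsWeakCurl.isStrongCurl {Ω : Opens R3} (h : IsWeakCurl Ω u w)
    (hbdd : Bornology.IsBounded (Ω : Set R3))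
    (hcone : ∀ z ∈ closure (Ω : Set R3), HasInwardConeAt (Ω : Set R3) z) (hp1 : 1 ≤ p)
    (hp : p ≠ ⊤) (hu : MemLp u p (volume.restrict (Ω : Set R3)))
    (hw : MemLp w p (volume.restrict (Ω : Set R3))) : IsStrongCurl p Ω u w :=
  .of_locally Ω.isOpen hbdd hp1 hu.1 hw.1 fun z hz =>
    h.exists_isStrongCurl_inter hp1 hp hu hw (hcone z hz)

end StrongCurl

section SobolevSpace

variable {Ω : Opens R3} {p : ℝ≥0∞}

theorem memLp_restrict_of_continuous_of_isBounded {E F : Type*} [MetricSpace E] [ProperSpace E]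
    [MeasurableSpace E] [OpensMeasurableSpace E] {μ : Measure E} [IsFiniteMeasureOnCompacts μ]
    [NormedAddCommGroup F] [SecondCountableTopology F] {S : Set E} (hS : Bornology.IsBounded S)
    {φ : E → F} (hφ : Continuous φ) : MemLp φ p (μ.restrict S) := by
  have hK := hS.isCompact_closure
  obtain ⟨C, hC⟩ := hK.exists_bound_of_continuousOn hφ.continuousOn
  have : IsFiniteMeasure (μ.restrict (closure S)) :=
    isFiniteMeasure_restrict.mpr hK.measure_ne_top
  exact (MemLp.of_bound hφ.aestronglyMeasurable C <|
    ae_restrict_of_forall_mem hK.measurableSet hC).mono_measure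
      (Measure.restrict_mono_set μ subset_closure)

theorem IsWeakCurl.congr_ae {u u' w w' : R3 → R3} (h : IsWeakCurl Ω u w)
    (hu : u =ᵐ[volume.restrict (Ω : Set R3)] u') (hw : w =ᵐ[volume.restrict (Ω : Set R3)] w') :
    IsWeakCurl Ω u' w' := by
  have hinner {a b : R3 → R3} (hab : a =ᵐ[volume.restrict (Ω : Set R3)] b) (φ : R3 → R3) :
      ∫ x in (Ω : Set R3), ⟪b x, φ x⟫_ℝ = ∫ x in (Ω : Set R3), ⟪a x, φ x⟫_ℝ :=
    integral_congr_ae (hab.mono fun x hx => by simp only [hx])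
  intro φ hφ
  rw [hinner hw, hinner hu, h φ hφ]

variable [Fact (1 ≤ p)]

namespace WCurl

theorem exists_represents (hbdd : Bornology.IsBounded (Ω : Set R3)) {φ : R3 → R3}
    (hφ : ContDiff ℝ ∞ φ) :
    ∃ u : WCurl p Ω, u.Represents φ ∧
      curl u =ᵐ[volume.restrict (Ω : Set R3)] classicalCurl φ := by
  have hφp : MemLp φ p (volume.restrict (Ω : Set R3)) :=
    memLp_restrict_of_continuous_of_isBounded hbdd hφ.continuous
  have hcp : MemLp (classicalCurl φ) p (volume.restrict (Ω : Set R3)) :=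
    memLp_restrict_of_continuous_of_isBounded hbdd (continuous_classicalCurl hφ)
  have hcurl : IsWeakCurl Ω (hφp.toLp φ) (hcp.toLp (classicalCurl φ)) :=
    (isWeakCurl_classicalCurl Ω (hφ.of_le (by simp))).congr_ae hφp.coeFn_toLp.symm
      hcp.coeFn_toLp.symm
  let u : WCurl p Ω := ⟨hφp.toLp φ, hcp.toLp (classicalCurl φ), hcurl⟩
  have hu : curl u = hcp.toLp (classicalCurl φ) := (isWeakCurl_curl u).unique hcurl
  exact ⟨u, hφp.coeFn_toLp, hu ▸ hcp.coeFn_toLp⟩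

theorem mem_closure_smoothFields (hbdd : Bornology.IsBounded (Ω : Set R3)) {u : WCurl p Ω}
    (h : IsStrongCurl p Ω (toLp u) (curl u)) : u ∈ closure (smoothFields p Ω) := by
  obtain ⟨v, hv, hvu, hvw⟩ := h
  choose V hV hV' using fun n => exists_represents (p := p) hbdd (hv n)
  have hlim : Tendsto (fun n => toLp (V n)) atTop (𝓝 (toLp u)) :=
    (Lp.tendsto_Lp_iff_tendsto_eLpNorm' _ _).mpr <| hvu.congr fun n =>
      eLpNorm_congr_ae ((hV n).symm.sub EventuallyEq.rfl)
  have hlim' : Tendsto (fun n => curl (V n)) atTop (𝓝 (curl u)) :=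
    (Lp.tendsto_Lp_iff_tendsto_eLpNorm' _ _).mpr <| hvw.congr fun n =>
      eLpNorm_congr_ae ((hV' n).symm.sub EventuallyEq.rfl)
  refine mem_closure_of_tendsto (f := V) (b := atTop) ?_
    (Eventually.of_forall fun n => ⟨v n, hv n, hV n⟩)
  rw [tendsto_iff_norm_sub_tendsto_zero] at hlim hlim' ⊢
  simpa only [norm_def, map_sub, add_zero] using hlim.add hlim'

end WCurl

end SobolevSpace

theorem mainTheorem11_general (Ω : Opens R3) (hbdd : Bornology.IsBounded (Ω : Set R3))
    (hcone : ∀ z ∈ closure (Ω : Set R3), HasInwardConeAt (Ω : Set R3) z)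
    (p : ℝ≥0∞) [Fact (1 ≤ p)] (hp : p ≠ ⊤) :
    (∀ φ : R3 → R3, ContDiff ℝ ∞ φ → ∃ u : WCurl p Ω, u.Represents φ) ∧
      Dense (smoothFields p Ω) :=
  ⟨fun _ hφ => (WCurl.exists_represents hbdd hφ).imp fun _ => And.left, fun u =>
    WCurl.mem_closure_smoothFields hbdd <| (WCurl.isWeakCurl_curl u).isStrongCurl hbdd hcone
      Fact.out hp (Lp.memLp _) (Lp.memLp _)⟩

theorem mainTheorem11 (Ω : Opens R3) (hbdd : Bornology.IsBounded (Ω : Set R3))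
    (hLip : HasLipschitzBoundary (Ω : Set R3))
    (p : ℝ≥0∞) [Fact (1 ≤ p)] (hp1 : 1 < p) (hp : p ≠ ⊤) :
    (∀ φ : R3 → R3, ContDiff ℝ ∞ φ → ∃ u : WCurl p Ω, u.Represents φ) ∧
      Dense (smoothFields p Ω) :=
  mainTheorem11_general Ω hbdd (fun _ => hLip.hasInwardConeAt Ω.isOpen) p hp
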